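/- Let $(X,\mu)$ be a standard Borel probability space and let $R\subseteq X\times X$ be a Borel equivalence relation with countable classes. For Borel $E\subseteq R$ put $\mu_L(E)=\int|\{y:(x,y)\in E\}|\,d\mu(x)$ and $\mu_R(E)=\int|\{x:(x,y)\in E\}|\,d\mu(y)$; $R$ is probability-measure-preserving (pmp) if $\mu_L=\mu_R$. An equivalence relation is ergodic if every measurable union of its classes has measure $0$ or $1$. A subequivalence relation of $R$ is a Borel equivalence relation $S\subseteq R$; it is proper if $\mu_L(R\setminus S)>0$. A graphing of $R$ is a symmetric Borel set $G\subseteq X\times X$ such that $R$ is the smallest equivalence relation containing $G$ (up to a null set of points); it is a treeing if almost every local graph (the graph that $G$ induces on a class of $R$) is a tree. $R$ is treeable if it has a treeing. The cost of $R$ is $\inf_G \frac12\int|\{y:(x,y)\in G\}|\,d\mu(x)$ over all graphings $G$ of $R$. A subequivalence relation $S$ of $R$ is primitive (a free factor) if there are treeings $G_S$ of $S$ and $G_R$ of $R$ with $G_S\subseteq G_R$. A subequivalence relation $N$ of $R$ is normal if there is a countable family of Borel maps $\varphi_j:X\to X$ such that, almost everywhere, the $N$-classes $[\varphi_j(x)]_N$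 form a partition (without repetitions) of $[x]_R$, and $(x,y)\in N$ implies $(\varphi_j(x),\varphi_j(y))\in N$ for all $j$. For $N$ ergodic and normal, $R/N\cong\Lambda$, where $\Lambda$ is a countable group, means that there is a Borel homomorphism (cocycle) $\theta:R\to\Lambda$ such that, almost everywhere: its kernel is $N$; it is class-surjective (for every $g\in\Lambda$ and $x\in X$ there is $y\in[x]_R$ with $\theta(x,y)=g$); and every Borel homomorphism $\theta'$ from $R$ to a discrete Borel groupoid $H'$ with $\ker\theta'\supseteq N$ has the form $\kappa\circ\theta$ for some homomorphism $\kappa:\Lambda\to H'$. Theorem. Let $R$ be a treeable ergodic pmp equivalence relation on $(X,\mu)$, with countable classes, of cost $>1$. Suppose that $R$ has a proper ergodic primitive subequivalence relation $S$. Then $R$ is large: for every countable (possibly finite) group $\Lambda$ there is an ergodic normal subequivalence relation $N$ of $R$ with $R/N\cong\Lambda$. -/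

import Mathlib

open MeasureTheory CategoryTheory

universe u v a b a' b'

namespace MeasuredRel

section Relations

variable {X : Type u} [MeasurableSpace X]

/-- The equivalence relation, as a subset of the square. -/
def graph (R : Setoid X) : Set (X × X) := {p | R p.1 p.2}

/-- The left measure of a set of pairs: the integral over `x` of the number of `y` with
`(x, y) ∈ E`. It is used for Borel sets with countable sections, where the integrand is a
Borel function. -/
noncomputable def leftMass (μ : Measure X) (E : Set (X × X)) : ENNReal :=
  ∫⁻ x, ((Set.encard {y | (x, y) ∈ E} : ℕ∞) : ENNReal) ∂μ

/-- The right measure of a set of pairs: the integral over `y` of the number of `x` with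
`(x, y) ∈ E`. -/
noncomputable def rightMass (μ : Measure X) (E : Set (X × X)) : ENNReal :=
  ∫⁻ y, ((Set.encard {x | (x, y) ∈ E} : ℕ∞) : ENNReal) ∂μ

/-- A discrete (countable classes) Borel equivalence relation. -/
structure IsDiscreteBorel (R : Setoid X) : Prop where
  measurableSet_graph : MeasurableSet (graph R)
  countable_class : ∀ x, {y | R x y}.Countable

/-- The relation preserves the measure: the left and right measures on it coincide. -/
def IsMeasurePreserving (μ : Measure X) (R : Setoid X) : Prop :=
  ∀ E : Set (X × X), E ⊆ graph R → MeasurableSet E → leftMass μ E = rightMass μ E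

/-- Every measurable saturated set has measure `0` or `1`. -/
def IsErgodic (μ : Measure X) (R : Setoid X) : Prop :=
  ∀ A : Set X, MeasurableSet A → (∀ x y, R x y → (x ∈ A ↔ y ∈ A)) → μ A = 0 ∨ μ A = 1

/-- `S` is a subequivalence relation of `R`: a Borel equivalence relation contained in `R`. -/
structure IsSubrelation (S R : Setoid X) : Prop where
  measurableSet_graph : MeasurableSet (graph S)
  le : ∀ x y, S x y → R x y

/-- Two relations agree almost everywhere. -/
def AgreeAE (μ : Measure X) (S R : Setoid X) : Prop :=
  leftMass μ (symmDiff (graph S) (graph R)) = 0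

/-- A graphing of `R` (up to a null set of points): a symmetric Borel set `G` such that `R` is
the smallest equivalence relation that contains `G`. -/
structure IsGraphing (μ : Measure X) (R : Setoid X) (G : Set (X × X)) : Prop where
  measurableSet : MeasurableSet G
  symm : ∀ x y, (x, y) ∈ G → (y, x) ∈ G
  generates : ∀ᵐ x ∂μ, ∀ y, R x y ↔ Relation.EqvGen (fun p q => (p, q) ∈ G) x y

/-- The local graph of `G` at `x`, on the class of `x`. -/
def localGraph (R : Setoid X) (G : Set (X × X)) (x : X) : SimpleGraph {y : X // R x y} :=
  SimpleGraph.fromRel fun y z => ((y : X), (z : X)) ∈ G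

/-- A treeing of `R`: a graphing without loops almost all of whose local graphs are trees. -/
structure IsTreeing (μ : Measure X) (R : Setoid X) (G : Set (X × X)) : Prop
    extends IsGraphing μ R G where
  no_loops : ∀ᵐ x ∂μ, (x, x) ∉ G
  isTree : ∀ᵐ x ∂μ, (localGraph R G x).IsTree

def IsTreeable (μ : Measure X) (R : Setoid X) : Prop :=
  ∃ G, IsTreeing μ R G

/-- The cost: the infimum over all graphings of half the average degree. -/
noncomputable def cost (μ : Measure X) (R : Setoid X) : ENNReal :=
  ⨅ (G : Set (X × X)) (_ : IsGraphing μ R G), leftMass μ G / 2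

/-- `S` is primitive in `R` (a free factor): some treeing of `S` extends to a treeing of `R`. -/
def IsPrimitive (μ : Measure X) (S R : Setoid X) : Prop :=
  ∃ GS GR : Set (X × X), IsTreeing μ S GS ∧ IsTreeing μ R GR ∧ GS ⊆ GR

/-- A countable family of Borel choice functions for `S` in `R`: for almost every `x` the
`S`-classes of the points `φ j x` form a partition (without repetitions) of the `R`-class
of `x`. -/
structure IsChoiceFamily (μ : Measure X) (S R : Setoid X) {J : Type} (φ : J → X → X) : Prop where
  measurable : ∀ j, Measurable (φ j)
  mem_class : ∀ᵐ x ∂μ, ∀ j, R x (φ j x)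
  partition : ∀ᵐ x ∂μ, ∀ y, R x y → ∃! j, S (φ j x) y

/-- `S` is normal in `R`: there are choice functions that are endomorphisms of `S`. -/
def IsNormal (μ : Measure X) (S R : Setoid X) : Prop :=
  ∃ (J : Type) (_ : Countable J) (φ : J → X → X), IsChoiceFamily μ S R φ ∧
    ∀ᵐ x ∂μ, ∀ j y, S x y → S (φ j x) (φ j y)

end Relations

section Groupoids

/-- A discrete Borel groupoid: a groupoid whose spaces of objects and of arrows are standard
Borel, whose structure maps are Borel, and whose source map is countable-to-one. -/
structure BorelGroupoid where
  Ob : Type a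
  [groupoid : Groupoid.{b} Ob]
  [measurableOb : MeasurableSpace Ob]
  [standardOb : StandardBorelSpace Ob]
  [measurableArrow : MeasurableSpace (Arrow Ob)]
  [standardArrow : StandardBorelSpace (Arrow Ob)]
  measurable_source : Measurable fun f : Arrow Ob => f.left
  measurable_target : Measurable fun f : Arrow Ob => f.right
  measurable_id : Measurable fun x : Ob => Arrow.mk (𝟙 x)
  measurable_inv : Measurable fun f : Arrow Ob => Arrow.mk (Groupoid.inv f.hom)
  measurable_comp : Measurable fun p : {p : Arrow Ob × Arrow Ob // p.1.right = p.2.left} =>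
    Arrow.mk (p.1.1.hom ≫ eqToHom p.2 ≫ p.1.2.hom)
  countable_source : ∀ x : Ob, {f : Arrow Ob | f.left = x}.Countable

attribute [instance] BorelGroupoid.groupoid BorelGroupoid.measurableOb
  BorelGroupoid.standardOb BorelGroupoid.measurableArrow BorelGroupoid.standardArrow

instance countable_arrow_singleObj (Λ : Type v) [Group Λ] [Countable Λ] :
    Countable (Arrow (SingleObj Λ)) :=
  Function.Surjective.countable
    (f := fun g : Λ => Arrow.mk (show SingleObj.star Λ ⟶ SingleObj.star Λ from g))
    fun f => ⟨f.hom, rfl⟩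

/-- A countable group, as a discrete Borel groupoid with one object. -/
def ofGroup (Λ : Type v) [Group Λ] [Countable Λ] : BorelGroupoid.{0, v} :=
  letI : MeasurableSpace (SingleObj Λ) := ⊤
  letI : MeasurableSpace (Arrow (SingleObj Λ)) := ⊤
  haveI : DiscreteMeasurableSpace (SingleObj Λ) := ⟨fun _ => trivial⟩
  haveI : DiscreteMeasurableSpace (Arrow (SingleObj Λ)) := ⟨fun _ => trivial⟩
  haveI : Countable (SingleObj Λ) := inferInstanceAs (Countable Unit)
  { Ob := SingleObj Λ
    measurable_source := measurable_of_countable _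
    measurable_target := measurable_of_countable _
    measurable_id := measurable_of_countable _
    measurable_inv := measurable_of_countable _
    measurable_comp := measurable_of_countable _
    countable_source := fun _ => Set.to_countable _ }

/-- A Borel homomorphism of Borel groupoids. -/
structure GroupoidHom (H : BorelGroupoid.{a, b}) (H' : BorelGroupoid.{a', b'}) where
  functor : H.Ob ⥤ H'.Ob
  measurable_obj : Measurable functor.obj
  measurable_map : Measurable fun f : Arrow H.Ob => Arrow.mk (functor.map f.hom)

variable {X : Type u} [MeasurableSpace X]

/-- A Borel homomorphism (cocycle) from the equivalence relation `R` to a Borel groupoid,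
multiplicative almost everywhere. -/
structure RelHom (μ : Measure X) (R : Setoid X) (H : BorelGroupoid.{a, b}) where
  obj : X → H.Ob
  map : ∀ x y, R x y → (obj x ⟶ obj y)
  measurable_obj : Measurable obj
  measurable_map : Measurable fun p : {p : X × X // R p.1 p.2} =>
    Arrow.mk (map p.1.1 p.1.2 p.2)
  map_comp : ∀ᵐ x ∂μ, ∀ y z (hxy : R x y) (hyz : R y z),
    map x z (R.trans hxy hyz) = map x y hxy ≫ map y z hyz

variable {μ : Measure X} {R : Setoid X}

/-- The pair `(x, y)` is in the kernel: it is sent to a unit. -/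
def RelHom.InKernel {H : BorelGroupoid.{a, b}} (θ : RelHom μ R H) (x y : X) (h : R x y) : Prop :=
  ∃ e : θ.obj x = θ.obj y, θ.map x y h = eqToHom e

/-- `θ : R → H` exhibits `H` as the quotient groupoid `R / N`: the kernel of `θ` is `N`, `θ` is
class-surjective, and each homomorphism from `R` to a discrete Borel groupoid whose kernel
contains `N` factors through `θ` (all of this almost everywhere). -/
structure IsQuotient (N : Setoid X) (H : BorelGroupoid.{a, b}) (θ : RelHom μ R H) : Prop where
  kernel : ∀ᵐ x ∂μ, ∀ y (h : R x y), N x y ↔ θ.InKernel x y h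
  class_surjective : ∀ᵐ x ∂μ, ∀ f : Arrow H.Ob, f.left = θ.obj x →
    ∃ y, ∃ h : R x y, Arrow.mk (θ.map x y h) = f
  universal : ∀ (H' : BorelGroupoid.{a', b'}) (θ' : RelHom μ R H'),
    (∀ᵐ x ∂μ, ∀ y (h : R x y), N x y → θ'.InKernel x y h) →
    ∃ κ : GroupoidHom H H', ∀ᵐ x ∂μ, ∀ y (h : R x y),
      Arrow.mk (κ.functor.map (θ.map x y h)) = Arrow.mk (θ'.map x y h)

/-- The quotient `R / N` is isomorphic to the countable group `Λ`. -/
def QuotientIso (μ : Measure X) (R N : Setoid X) (Λ : Type v) [Group Λ] [Countable Λ] : Prop :=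
  ∃ θ : RelHom μ R (ofGroup Λ), IsQuotient.{u, 0, v, a', b'} N (ofGroup Λ) θ

/-- `R` is large: every countable group is the quotient of `R` by an ergodic normal
subequivalence relation. -/
def IsLarge (μ : Measure X) (R : Setoid X) : Prop :=
  ∀ (Λ : Type v) [Group Λ] [Countable Λ], ∃ N : Setoid X,
    IsSubrelation N R ∧ IsErgodic μ N ∧ IsNormal μ N R ∧ QuotientIso.{u, v, a', b'} μ R N Λ

end Groupoids

end MeasuredRel

namespace MeasuredRel

/-! ### Analytic sets: null measurability and measurable selection. -/

section Analytic

open Set Filter Topology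

/-! Label the edges of a treeing of `R` by elements of `Λ`, with inverse labels on reversed edges.
The product of labels along a path in a tree depends only on its end points (`PathProduct.unique`),
so the labelling extends to a cocycle `θ` of `R`. Take treeings `GS ⊆ GR` of `S` and `R` and label
`GS` by `1`; then `θ` is trivial on `S`. As `S` is proper and the measure has no atoms, the other
edges can be labelled so that each `g` occurs on edges issuing from a set of positive measure. By
ergodicity almost every `S`-class meets each of these sets, and moving inside `S` costs nothing, so
`θ` is class-surjective (`exists_cocycle`).

`N` is the kernel of `θ`. It contains `S` almost everywhere, hence is ergodic; Borel choices of
points at prescribed values of `θ` show that it is normal. If `θ'` is trivial on `N`, its value on a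
pair with `θ x y = g` is `N`-invariant in `x`, hence constant, and these constants define `κ`
(`IsCocycleOn.exists_factor`).

Projections of Borel sets are treated as analytic sets, and exceptional points are removed by
passing to saturated conull Borel sets. -/

theorem analyticSet_inter {X : Type*} [TopologicalSpace X] [T2Space X] {s t : Set X}
    (hs : AnalyticSet s) (ht : AnalyticSet t) : AnalyticSet (s ∩ t) := by
  rw [inter_eq_iInter]
  exact AnalyticSet.iInter fun b => by cases b <;> simpa

theorem measurable_sInf_nat {X : Type*} [MeasurableSpace X] {P : ℕ → Set X}
    (hP : ∀ n, MeasurableSet (P n)) : Measurable fun x => sInf {n | x ∈ P n} := by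
  refine measurable_to_countable' fun n => ?_
  -- Since `sInf ∅ = 0`, the fibre over `0` also contains the points that lie in no `P m`.
  have h : (fun x => sInf {n | x ∈ P n}) ⁻¹' {n} =
      (P n ∩ ⋂ m, ⋂ (_ : m < n), (P m)ᶜ) ∪ ((⋂ m, (P m)ᶜ) ∩ {_x | n = 0}) := by
    ext x
    simp only [mem_preimage, mem_singleton_iff, mem_union, mem_inter_iff, mem_iInter, mem_compl_iff,
      mem_ofPred_eq]
    constructor
    · rintro rfl
      by_cases hne : {n | x ∈ P n}.Nonempty
      · exact Or.inl ⟨Nat.sInf_mem hne, fun m hm => Nat.notMem_of_lt_sInf hm⟩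
      · rw [not_nonempty_iff_eq_empty] at hne
        exact Or.inr ⟨fun m hm => (hne ▸ (show m ∈ {n | x ∈ P n} from hm) : m ∈ (∅ : Set ℕ)),
          by rw [hne, Nat.sInf_empty]⟩
    · rintro (⟨h1, h2⟩ | ⟨h1, rfl⟩)
      · refine le_antisymm (Nat.sInf_le h1) ?_
        by_contra! hlt
        exact h2 _ hlt (Nat.sInf_mem (s := {n | x ∈ P n}) ⟨n, h1⟩)
      · have : {n | x ∈ P n} = ∅ := eq_empty_of_forall_notMem h1
        rw [this, Nat.sInf_empty]
  rw [h]
  exact ((hP n).inter (.iInter fun m => .iInter fun _ => (hP m).compl)).union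
    ((MeasurableSet.iInter fun m => (hP m).compl).inter (.const _))

/-- The intersection of the closures of the images of the boxes given by the first `k` coordinates
is the image of the whole box. -/
theorem iInter_closure_image_subset {X : Type*} [TopologicalSpace X] [T2Space X]
    {f : (ℕ → ℕ) → X} (hf : Continuous f) (n : ℕ → ℕ) :
    ⋂ k, closure (f '' {β | ∀ i < k, β i ≤ n i}) ⊆ f '' {β | ∀ i, β i ≤ n i} := by
  intro y hy
  by_contra hyK
  have hKc : IsCompact {β : ℕ → ℕ | ∀ i, β i ≤ n i} := by
    have : {β : ℕ → ℕ | ∀ i, β i ≤ n i} = Set.pi univ fun i => Iic (n i) := by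
      ext β; simp [Pi.le_def]
    rw [this]
    exact isCompact_univ_pi fun i => (finite_Iic _).isCompact
  obtain ⟨U, V, hU, hV, hyU, hKV, hUV⟩ : ∃ U V, IsOpen U ∧ IsOpen V ∧ y ∈ U ∧
      f '' {β | ∀ i, β i ≤ n i} ⊆ V ∧ Disjoint U V := by
    obtain ⟨U, V, hU, hV, h1, h2, h3⟩ := SeparatedNhds.of_isCompact_isCompact
      (isCompact_singleton (x := y)) (hKc.image hf) (by simpa using hyK)
    exact ⟨U, V, hU, hV, by simpa using h1, h2, h3⟩
  have hex : ∀ k, ∃ β : ℕ → ℕ, (∀ i < k, β i ≤ n i) ∧ f β ∉ V := by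
    intro k
    obtain ⟨z, hzU, β, hβ, rfl⟩ := mem_closure_iff.1 (mem_iInter.1 hy k) U hU hyU
    exact ⟨β, hβ, fun h => disjoint_left.1 hUV hzU h⟩
  choose β hβ hβV using hex
  -- Truncation by `n` puts the points in the compact box, and leaves coordinate `i` unchanged once
  -- `k > i`; so the untruncated subsequence has the same limit.
  obtain ⟨γ, hγ, φ, hφ, hlim⟩ := hKc.tendsto_subseq (x := fun k i => min (β k i) (n i))
    fun k i => min_le_right _ _
  have hlim' : Tendsto (fun k => β (φ k)) atTop (𝓝 γ) := by
    rw [tendsto_pi_nhds] at hlim ⊢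
    intro i
    refine (hlim i).congr' ?_
    filter_upwards [eventually_gt_atTop i] with k hk
    exact min_eq_left (hβ _ i (hk.trans_le (hφ.id_le k)))
  have hcl : γ ∈ (f ⁻¹' V)ᶜ :=
    (hV.preimage hf).isClosed_compl.mem_of_tendsto hlim' (.of_forall fun k => hβV _)
  exact hcl (hKV ⟨γ, hγ, rfl⟩)

/-- Capacitability: the image of a continuous map on the Baire space is approximated in measure
by measurable subsets. -/
theorem exists_measurableSet_subset_range_lt {X : Type*} [TopologicalSpace X] [T2Space X]
    [MeasurableSpace X] [OpensMeasurableSpace X] (μ : Measure X) [IsFiniteMeasure μ]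
    {f : (ℕ → ℕ) → X} (hf : Continuous f) {m : ENNReal} (hm : m < μ (range f)) :
    ∃ K, MeasurableSet K ∧ K ⊆ range f ∧ m ≤ μ K := by
  have hstep : ∀ (C : Set (ℕ → ℕ)) (k : ℕ), ∃ n, m < μ (f '' C) →
      m < μ (f '' (C ∩ {β | β k ≤ n})) := by
    intro C k
    by_cases hC : m < μ (f '' C)
    · have hU : f '' C = ⋃ n, f '' (C ∩ {β | β k ≤ n}) := by
        rw [← image_iUnion, ← inter_iUnion]
        congr 1
        refine (inter_eq_left.2 fun β _ => ?_).symm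
        exact mem_iUnion.2 ⟨β k, show β k ≤ β k from le_rfl⟩
      -- These images need not be measurable, but continuity from below along increasing sequences
      -- holds for arbitrary sets.
      have hmono : Monotone fun n => f '' (C ∩ {β | β k ≤ n}) := fun a b hab =>
        image_mono (inter_subset_inter_right _ fun β (h : β k ≤ a) => h.trans hab)
      rw [hU, hmono.measure_iUnion] at hC
      obtain ⟨n, hn⟩ := lt_iSup_iff.1 hC
      exact ⟨n, fun _ => hn⟩
    · exact ⟨0, fun h => absurd h hC⟩
  choose N hN using hstep
  let C : ℕ → Set (ℕ → ℕ) := fun k =>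
    Nat.rec univ (fun k C => C ∩ {β | β k ≤ N C k}) k
  have hCm : ∀ k, m < μ (f '' C k) := by
    intro k
    induction k with
    | zero => simpa [C] using hm
    | succ k ih => exact hN _ _ ih
  let n : ℕ → ℕ := fun k => N (C k) k
  have hC : ∀ k, C k = {β | ∀ i < k, β i ≤ n i} := by
    intro k
    induction k with
    | zero => simp [C]
    | succ k ih =>
      change C k ∩ {β | β k ≤ n k} = _
      rw [ih]
      ext β
      simp only [mem_inter_iff, mem_ofPred_eq, Nat.lt_succ_iff_lt_or_eq]
      exact ⟨fun h i hi => hi.elim (h.1 i) (fun e => e ▸ h.2),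
        fun h => ⟨fun i hi => h i (Or.inl hi), h k (Or.inr rfl)⟩⟩
  refine ⟨⋂ k, closure (f '' C k), .iInter fun k => isClosed_closure.measurableSet, ?_, ?_⟩
  · simp_rw [hC]
    exact (iInter_closure_image_subset hf n).trans (image_subset_range _ _)
  · have hanti : Antitone fun k => closure (f '' C k) :=
      antitone_nat_of_succ_le fun k => closure_mono (image_mono inter_subset_left)
    refine ge_of_tendsto' (tendsto_measure_iInter_atTop
      (fun k => isClosed_closure.measurableSet.nullMeasurableSet) hanti
      ⟨0, measure_ne_top _ _⟩) fun k => ?_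
    exact (hCm k).le.trans (measure_mono subset_closure)

/-- Measurable subsets whose measures approach the outer measure have a union of full measure in the
set; finiteness of `μ` makes the difference null. -/
theorem nullMeasurableSet_of_analyticSet {X : Type*} [TopologicalSpace X] [T2Space X]
    [MeasurableSpace X] [OpensMeasurableSpace X] (μ : Measure X) [IsFiniteMeasure μ]
    {s : Set X} (hs : AnalyticSet s) : NullMeasurableSet s μ := by
  rw [AnalyticSet] at hs
  obtain rfl | ⟨f, hf, rfl⟩ := hs
  · exact .empty
  by_cases h0 : μ (range f) = 0
  · exact .of_null h0
  obtain ⟨m, -, hm, hlim⟩ := exists_seq_strictMono_tendsto' (pos_iff_ne_zero.2 h0)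
  choose K hK hKs hKm using fun k => exists_measurableSet_subset_range_lt μ hf (hm k).2
  have hU : MeasurableSet (⋃ k, K k) := .iUnion hK
  have hsub : ⋃ k, K k ⊆ range f := iUnion_subset hKs
  refine hU.nullMeasurableSet.congr ?_
  refine ae_eq_of_subset_of_measure_ge hsub ?_ hU.nullMeasurableSet (measure_ne_top _ _)
  exact le_of_tendsto' hlim fun k => (hKm k).trans (measure_mono (subset_iUnion K k))

/-- Measurable selection almost everywhere for analytic sets. -/
theorem exists_measurable_selection {X Y : Type*} [TopologicalSpace X] [T2Space X]
    [MeasurableSpace X] [BorelSpace X] [TopologicalSpace Y]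
    [MeasurableSpace Y] [BorelSpace Y] [SecondCountableTopology X]
    (μ : Measure X) [IsProbabilityMeasure μ] {E : Set (X × Y)} (hE : AnalyticSet E)
    (h : ∀ᵐ x ∂μ, ∃ y, (x, y) ∈ E) :
    ∃ φ : X → Y, Measurable φ ∧ ∀ᵐ x ∂μ, (x, φ x) ∈ E := by
  rw [AnalyticSet] at hE
  obtain rfl | ⟨f, hf, rfl⟩ := hE
  · obtain ⟨x, y, hy⟩ := h.exists
    exact absurd hy (notMem_empty _)
  let cyl : List ℕ → Set (ℕ → ℕ) := fun l => {β | ∀ i < l.length, β i = l.getD i 0}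
  let U : List ℕ → Set X := fun l => (fun β => (f β).1) '' cyl l
  have hcyl : ∀ l, MeasurableSet (cyl l) := fun l => by
    have : cyl l = ⋂ i, ⋂ (_ : i < l.length), {β | β i = l.getD i 0} := by
      ext β; simp [cyl]
    rw [this]
    exact .iInter fun i => .iInter fun _ => measurable_pi_apply i (measurableSet_singleton _)
  have hU : ∀ l, NullMeasurableSet (U l) μ := fun l =>
    nullMeasurableSet_of_analyticSet μ
      ((hcyl l).analyticSet_image (continuous_fst.comp hf).measurable)
  -- The projections `U l` of cylinders are only null measurable, so the search for the next
  -- coordinate uses measurable hulls. There are countably many `l`, so almost everywhere hull and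
  -- projection agree for all of them.
  choose B hUB hB hBU using fun l => (hU l).exists_measurable_superset_ae_eq
  let step : List ℕ → X → ℕ := fun l x => sInf {n | x ∈ B (l ++ [n])}
  have hstep : ∀ l, Measurable (step l) := fun l => measurable_sInf_nat fun n => (hB _)
  let L : ℕ → X → List ℕ := fun k => Nat.rec (fun _ => []) (fun _ L x => L x ++ [step (L x) x]) k
  have hLs : ∀ k x, L (k + 1) x = L k x ++ [step (L k x) x] := fun k x => rfl
  let β : X → ℕ → ℕ := fun x k => step (L k x) x
  have hLlen : ∀ k x, (L k x).length = k := by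
    intro k x
    induction k with
    | zero => rfl
    | succ k ih => rw [hLs, List.length_append, ih]; rfl
  have hLget : ∀ x k i, i < k → (L k x).getD i 0 = β x i := by
    intro x k i hi
    induction k with
    | zero => omega
    | succ k ih =>
      rw [hLs]
      rcases Nat.lt_succ_iff_lt_or_eq.1 hi with h | rfl
      · rw [List.getD_append _ _ _ _ (by rwa [hLlen]), ih h]
      · rw [List.getD_append_right _ _ _ _ (by rw [hLlen]), hLlen]
        simp [β]
  let _ : MeasurableSpace (List ℕ) := ⊤
  have : DiscreteMeasurableSpace (List ℕ) := ⟨fun _ => trivial⟩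
  have hstep2 : Measurable fun p : List ℕ × X => step p.1 p.2 :=
    measurable_from_prod_countable_right hstep
  have hL : ∀ k, Measurable (L k) := by
    intro k
    induction k with
    | zero => exact measurable_const
    | succ k ih =>
      have : Measurable fun p : List ℕ × ℕ => p.1 ++ [p.2] := .of_discrete
      exact this.comp (ih.prodMk (hstep2.comp (ih.prodMk measurable_id)))
  have hβ : Measurable β := measurable_pi_lambda _ fun k =>
    hstep2.comp ((hL k).prodMk measurable_id)
  refine ⟨fun x => (f (β x)).2, (continuous_snd.comp hf).measurable.comp hβ, ?_⟩
  have hgood : ∀ᵐ x ∂μ, ∀ l, x ∈ B l → x ∈ U l := ae_all_iff.2 fun l => by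
    filter_upwards [hBU l] with x hx hxB
    exact hx.mp hxB
  filter_upwards [h, hgood] with x ⟨y, hy⟩ hx
  have hUL : ∀ k, x ∈ U (L k x) := by
    intro k
    induction k with
    | zero =>
      obtain ⟨γ, hγ⟩ := hy
      exact ⟨γ, fun i hi => absurd hi (Nat.not_lt_zero i), by simp [hγ]⟩
    | succ k ih =>
      obtain ⟨γ, hγ, hγx⟩ := ih
      have hne : {n | x ∈ B (L k x ++ [n])}.Nonempty := by
        refine ⟨γ k, hUB _ ⟨γ, fun i hi => ?_, hγx⟩⟩
        rw [List.length_append, hLlen, List.length_singleton] at hi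
        rcases Nat.lt_succ_iff_lt_or_eq.1 hi with h | rfl
        · rw [List.getD_append _ _ _ _ (by rwa [hLlen])]
          exact hγ i (by rwa [hLlen])
        · rw [List.getD_append_right _ _ _ _ (by rw [hLlen]), hLlen]
          simp
      rw [hLs]
      exact hx _ (Nat.sInf_mem hne)
  choose γ hγ hγx using hUL
  -- The witness `γ k` agrees with `β x` on the first `k` coordinates and lies over `x`; by
  -- continuity `β x` lies over `x` too.
  have hlim : Tendsto γ atTop (𝓝 (β x)) := by
    rw [tendsto_pi_nhds]
    intro i
    refine tendsto_const_nhds.congr' ?_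
    filter_upwards [eventually_gt_atTop i] with k hk
    rw [hγ k i (by rwa [hLlen]), hLget x k i hk]
  have hfst : (f (β x)).1 = x :=
    tendsto_nhds_unique (((continuous_fst.comp hf).tendsto _).comp hlim)
      (tendsto_const_nhds.congr fun k => (hγx k).symm)
  exact ⟨β x, Prod.ext hfst rfl⟩

end Analytic

/-! ### Null sets, saturated sets and ergodicity. -/

section Saturation

open Set Filter

variable {X : Type u}

/-- The saturation of `Z`: the union of the classes that meet `Z`. -/
def saturation (R : Setoid X) (Z : Set X) : Set X := {x | ∃ y ∈ Z, R x y}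

theorem subset_saturation (R : Setoid X) (Z : Set X) : Z ⊆ saturation R Z :=
  fun x hx => ⟨x, hx, R.refl x⟩

theorem mem_saturation_iff {R : Setoid X} {Z : Set X} {x y : X} (h : R x y) :
    x ∈ saturation R Z ↔ y ∈ saturation R Z :=
  ⟨fun ⟨z, hz, hxz⟩ => ⟨z, hz, R.trans (R.symm h) hxz⟩, fun ⟨z, hz, hyz⟩ => ⟨z, hz, R.trans h hyz⟩⟩

variable [MeasurableSpace X] [StandardBorelSpace X]

theorem nullMeasurableSet_fst_image (μ : Measure X) [IsFiniteMeasure μ] {E : Set (X × X)}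
    (hE : MeasurableSet E) : NullMeasurableSet (Prod.fst '' E) μ := by
  let _ := upgradeStandardBorel X
  exact nullMeasurableSet_of_analyticSet μ (hE.analyticSet_image measurable_fst)

theorem nullMeasurableSet_saturation (μ : Measure X) [IsFiniteMeasure μ] {R : Setoid X}
    (hR : MeasurableSet (graph R)) {Z : Set X} (hZ : MeasurableSet Z) :
    NullMeasurableSet (saturation R Z) μ := by
  have : saturation R Z = Prod.fst '' (graph R ∩ Prod.snd ⁻¹' Z) := by
    ext x
    constructor
    · rintro ⟨y, hy, hxy⟩
      exact ⟨(x, y), ⟨hxy, hy⟩, rfl⟩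
    · rintro ⟨⟨x, y⟩, ⟨hxy, hy⟩, rfl⟩
      exact ⟨y, hy, hxy⟩
  rw [this]
  exact nullMeasurableSet_fst_image μ (hR.inter (measurable_snd hZ))

variable {μ : Measure X} [IsProbabilityMeasure μ] {R : Setoid X}

/-- The pairs of `R` ending in a null set have right mass zero, hence left mass zero, and every
point of the saturation contributes at least one pair to the left mass. -/
theorem measure_saturation_eq_zero (hR : MeasurableSet (graph R)) (hpmp : IsMeasurePreserving μ R)
    {Z : Set X} (hZ : μ Z = 0) : μ (saturation R Z) = 0 := by
  obtain ⟨Z', hZZ', hZ'm, hZ'⟩ := exists_measurable_superset_of_null hZ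
  refine measure_mono_null (t := saturation R Z') (fun x ⟨y, hy, h⟩ => ⟨y, hZZ' hy, h⟩) ?_
  have h := hpmp (graph R ∩ Prod.snd ⁻¹' Z') inter_subset_left (hR.inter (measurable_snd hZ'm))
  have hr : rightMass μ (graph R ∩ Prod.snd ⁻¹' Z') = 0 := by
    refine (lintegral_congr_ae ?_).trans lintegral_zero
    filter_upwards [measure_eq_zero_iff_ae_notMem.1 hZ'] with y hy
    have : {x | (x, y) ∈ graph R ∩ Prod.snd ⁻¹' Z'} = ∅ :=
      eq_empty_of_forall_notMem fun x hx => hy hx.2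
    rw [this, encard_empty, ENat.toENNReal_zero]
  rw [hr] at h
  rw [← lintegral_indicator_one₀ (nullMeasurableSet_saturation μ hR hZ'm), ← le_zero_iff, ← h]
  refine lintegral_mono fun x => ?_
  by_cases hx : x ∈ saturation R Z'
  · obtain ⟨y, hy, hxy⟩ := hx
    have h1 : (1 : ℕ∞) ≤ Set.encard {y | (x, y) ∈ graph R ∩ Prod.snd ⁻¹' Z'} :=
      one_le_encard_iff_nonempty.2 ⟨y, hxy, hy⟩
    rw [indicator_of_mem (show x ∈ saturation R Z' from ⟨y, hy, hxy⟩), Pi.one_apply]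
    simpa using ENat.toENNReal_mono h1
  · rw [indicator_of_notMem hx]
    exact zero_le

/-- Every null set is contained in a Borel saturated null set. -/
theorem exists_saturated_null_superset (hR : MeasurableSet (graph R))
    (hpmp : IsMeasurePreserving μ R) {Z : Set X} (hZ : μ Z = 0) :
    ∃ W, Z ⊆ W ∧ MeasurableSet W ∧ μ W = 0 ∧ ∀ x y, R x y → (x ∈ W ↔ y ∈ W) := by
  have hstep : ∀ A : Set X, ∃ B, μ A = 0 → saturation R A ⊆ B ∧ MeasurableSet B ∧ μ B = 0 := by
    intro A
    by_cases hA : μ A = 0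
    · obtain ⟨B, h⟩ := exists_measurable_superset_of_null (measure_saturation_eq_zero hR hpmp hA)
      exact ⟨B, fun _ => h⟩
    · exact ⟨∅, fun h => absurd h hA⟩
  choose N hN using hstep
  -- A measurable hull of a saturation need not be saturated; iterating saturation and hull
  -- countably often repairs this. The union below starts at `W 1` because `W 0 = Z` need not be
  -- Borel.
  let W : ℕ → Set X := fun n => Nat.rec Z (fun _ A => N A) n
  have hW0 : ∀ n, μ (W n) = 0 := by
    intro n
    induction n with
    | zero => exact hZ
    | succ n ih => exact (hN _ ih).2.2
  have hsat : ∀ n, saturation R (W n) ⊆ W (n + 1) := fun n => (hN _ (hW0 n)).1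
  have hinv : ∀ x y, R x y → y ∈ ⋃ n, W (n + 1) → x ∈ ⋃ n, W (n + 1) := by
    intro x y hxy hy
    obtain ⟨n, hn⟩ := mem_iUnion.1 hy
    exact mem_iUnion.2 ⟨n + 1, hsat (n + 1) ⟨y, hn, hxy⟩⟩
  refine ⟨⋃ n, W (n + 1), ?_, .iUnion fun n => (hN _ (hW0 n)).2.1,
    measure_iUnion_null fun n => hW0 (n + 1),
    fun x y hxy => ⟨hinv y x (R.symm hxy), hinv x y hxy⟩⟩
  exact ((subset_saturation R Z).trans (hsat 0)).trans (subset_iUnion (fun n => W (n + 1)) 0)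

/-- A property that holds almost everywhere holds on a Borel saturated conull set. -/
theorem exists_saturated_conull (hR : MeasurableSet (graph R))
    (hpmp : IsMeasurePreserving μ R) {p : X → Prop} (hp : ∀ᵐ x ∂μ, p x) :
    ∃ W, MeasurableSet W ∧ (∀ᵐ x ∂μ, x ∈ W) ∧ (∀ x y, R x y → (x ∈ W ↔ y ∈ W)) ∧
      ∀ x ∈ W, p x := by
  obtain ⟨W, hpW, hWm, hW0, hW⟩ := exists_saturated_null_superset hR hpmp (ae_iff.1 hp)
  refine ⟨Wᶜ, hWm.compl, measure_eq_zero_iff_ae_notMem.1 hW0, fun x y h => not_congr (hW x y h), ?_⟩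
  intro x hx
  by_contra h
  exact hx (hpW h)

theorem ae_forall_rel (hR : MeasurableSet (graph R)) (hpmp : IsMeasurePreserving μ R)
    {p : X → Prop} (hp : ∀ᵐ x ∂μ, p x) : ∀ᵐ x ∂μ, ∀ y, R x y → p y := by
  obtain ⟨W, -, hW, hinv, h⟩ := exists_saturated_conull hR hpmp hp
  filter_upwards [hW] with x hx y hxy
  exact h y ((hinv x y hxy).1 hx)

/-- An ergodic subrelation has no null-measurable saturated sets of intermediate measure. -/
theorem IsErgodic.measure_eq_zero_or_one (hR : MeasurableSet (graph R))
    (hpmp : IsMeasurePreserving μ R) {S : Setoid X} (hSR : ∀ x y, S x y → R x y)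
    (hS : IsErgodic μ S) {A : Set X} (hA : NullMeasurableSet A μ)
    (hinv : ∀ x y, S x y → (x ∈ A ↔ y ∈ A)) : μ A = 0 ∨ μ A = 1 := by
  obtain ⟨B, hB, hAB⟩ := hA
  -- `IsErgodic` concerns exactly saturated Borel sets. On a saturated `W` where `A` and `B` agree,
  -- `B ∩ W` is one.
  obtain ⟨W, hWm, hW, hWinv, hWp⟩ := exists_saturated_conull hR hpmp hAB.mem_iff
  have hAe : A =ᵐ[μ] (B ∩ W : Set X) := by
    filter_upwards [hW] with x hx
    exact propext ⟨fun h => ⟨(hWp x hx).1 h, hx⟩, fun h => (hWp x hx).2 h.1⟩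
  rw [measure_congr hAe]
  refine hS _ (hB.inter hWm) fun x y hxy => ?_
  constructor
  · rintro ⟨h1, h2⟩
    have h3 := (hWinv x y (hSR _ _ hxy)).1 h2
    exact ⟨(hWp y h3).1 ((hinv x y hxy).1 ((hWp x h2).2 h1)), h3⟩
  · rintro ⟨h1, h2⟩
    have h3 := (hWinv x y (hSR _ _ hxy)).2 h2
    exact ⟨(hWp x h3).1 ((hinv x y hxy).2 ((hWp y h2).2 h1)), h3⟩

/-- The classes of an ergodic subrelation almost surely meet every set of positive measure. -/
theorem IsErgodic.ae_mem_saturation (hR : MeasurableSet (graph R))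
    (hpmp : IsMeasurePreserving μ R) {S : Setoid X} (hSR : IsSubrelation S R)
    (hS : IsErgodic μ S) {B : Set X} (hB : MeasurableSet B) (hB0 : μ B ≠ 0) :
    ∀ᵐ x ∂μ, x ∈ saturation S B := by
  have hn := nullMeasurableSet_saturation μ hSR.measurableSet_graph hB
  rcases hS.measure_eq_zero_or_one hR hpmp hSR.le hn fun x y => mem_saturation_iff with h | h
  · exact absurd (measure_mono_null (subset_saturation S B) h) hB0
  · exact (mem_ae_iff_prob_eq_one₀ hn).2 h

/-- A Borel map that is invariant, almost everywhere, under an ergodic subrelation is constant. -/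
theorem IsErgodic.exists_ae_eq_const (hR : MeasurableSet (graph R))
    (hpmp : IsMeasurePreserving μ R) {S : Setoid X} (hSR : ∀ x y, S x y → R x y)
    (hS : IsErgodic μ S) {Y : Type*} [MeasurableSpace Y] [StandardBorelSpace Y]
    {F : X → Y} (hF : Measurable F) (hinv : ∀ᵐ x ∂μ, ∀ y, S x y → F x = F y) :
    ∃ c, ∀ᵐ x ∂μ, F x = c := by
  obtain ⟨x₀⟩ := nonempty_of_isProbabilityMeasure μ
  have : Nonempty Y := ⟨F x₀⟩
  obtain ⟨W, hWm, hW, hWinv, hWp⟩ := exists_saturated_conull hR hpmp hinv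
  -- Countably many Borel sets separate the points of `Y`, so it suffices that each preimage is null
  -- or conull.
  refine Filter.exists_eventuallyEq_const_of_forall_separating (l := ae μ) (f := F)
    MeasurableSet fun U hU => ?_
  have hm : MeasurableSet (F ⁻¹' U ∩ W) := (hF hU).inter hWm
  have h01 : μ (F ⁻¹' U ∩ W) = 0 ∨ μ (F ⁻¹' U ∩ W) = 1 := by
    refine hS _ hm fun x y hxy => ?_
    constructor
    · rintro ⟨h1, h2⟩
      exact ⟨by rw [mem_preimage, ← hWp x h2 y hxy]; exact h1, (hWinv x y (hSR _ _ hxy)).1 h2⟩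
    · rintro ⟨h1, h2⟩
      have h3 := (hWinv x y (hSR _ _ hxy)).2 h2
      exact ⟨by rw [mem_preimage, hWp x h3 y hxy]; exact h1, h3⟩
  rcases h01 with h | h
  · right
    filter_upwards [measure_eq_zero_iff_ae_notMem.1 h, hW] with x hx hxW hU
    exact hx ⟨hU, hxW⟩
  · left
    filter_upwards [(mem_ae_iff_prob_eq_one hm).2 h] with x hx
    exact hx.1

/-- A proper ergodic subrelation exists only over an atomless measure. -/
theorem IsErgodic.measure_singleton_eq_zero (hR : IsDiscreteBorel R)
    (hpmp : IsMeasurePreserving μ R) {S : Setoid X} (hSR : IsSubrelation S R)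
    (hS : IsErgodic μ S) (hne : ¬ ∀ᵐ x ∂μ, ∀ y, R x y → S x y) (x : X) : μ {x} = 0 := by
  by_contra hx
  have hsat : ∀ w, μ {w} ≠ 0 → ∀ᵐ y ∂μ, S y w := fun w hw => by
    filter_upwards [hS.ae_mem_saturation hR.measurableSet_graph hpmp hSR
      (measurableSet_singleton w) hw] with y ⟨_, hw', hy⟩
    exact hw' ▸ hy
  refine hne ?_
  filter_upwards [hsat x hx] with y hyx z hyz
  -- An `R`-equivalent of an atom is an atom, and almost every point is `S`-equivalent to any given
  -- atom; hence all atoms share one `S`-class.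
  have hz : μ {z} ≠ 0 := fun h0 => hx <| measure_mono_null
    (singleton_subset_iff.2 (show x ∈ saturation R {z} from
      ⟨z, rfl, R.trans (R.symm (hSR.le _ _ hyx)) hyz⟩))
    (measure_saturation_eq_zero hR.measurableSet_graph hpmp h0)
  obtain ⟨w, hwz, hwx⟩ := ((hsat z hz).and (hsat x hx)).exists
  exact S.trans hyx (S.trans (S.symm hwx) hwz)

/-- A set of positive measure over an atomless measure splits into two such sets. -/
theorem exists_split (hat : ∀ x, μ {x} = 0) {A : Set X} (hA : μ A ≠ 0) :
    ∃ B, MeasurableSet B ∧ μ (A ∩ B) ≠ 0 ∧ μ (A \ B) ≠ 0 := by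
  by_contra! h
  obtain ⟨x₀⟩ := nonempty_of_isProbabilityMeasure μ
  have : Nonempty X := ⟨x₀⟩
  -- Without a splitting, every Borel set is null or conull in `A`, so the identity is almost
  -- everywhere constant on `A`, which makes `a` an atom.
  obtain ⟨a, ha⟩ := Filter.exists_eventuallyEq_const_of_forall_separating
    (l := ae (μ.restrict A)) (f := id) MeasurableSet fun U hU => by
      by_cases h0 : μ (A ∩ U) = 0
      · right
        refine measure_eq_zero_iff_ae_notMem.1 ?_
        rw [Measure.restrict_apply hU, inter_comm, h0]
      · left
        change U ∈ ae (μ.restrict A)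
        rw [mem_ae_iff, Measure.restrict_apply hU.compl, inter_comm, ← sdiff_eq, h U hU h0]
  refine hA ?_
  have h1 : μ.restrict A {a}ᶜ = 0 := ha
  rw [Measure.restrict_apply (measurableSet_singleton a).compl] at h1
  exact measure_mono_null (fun x hx => by
    by_cases e : x = a
    exacts [Or.inr e, Or.inl ⟨e, hx⟩]) (measure_union_null h1 (hat a))

/-- Over an atomless measure there is a Borel colouring by natural numbers each of whose colours
has positive measure within the given set. -/
theorem exists_measurable_nat_coloring (hat : ∀ x, μ {x} = 0) {A : Set X} (hA : μ A ≠ 0) :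
    ∃ c : X → ℕ, Measurable c ∧ ∀ n, μ (A ∩ c ⁻¹' {n}) ≠ 0 := by
  have hstep : ∀ C : Set X, ∃ B, MeasurableSet B ∧
      (μ (A ∩ C) ≠ 0 → μ (A ∩ C ∩ B) ≠ 0 ∧ μ ((A ∩ C) \ B) ≠ 0) := by
    intro C
    by_cases hC : μ (A ∩ C) = 0
    · exact ⟨∅, .empty, fun h => absurd hC h⟩
    · obtain ⟨B, hB, h⟩ := exists_split hat hC
      exact ⟨B, hB, fun _ => h⟩
  choose P hPm hP using hstep
  let C : ℕ → Set X := fun n => Nat.rec univ (fun _ C => C ∩ P C) n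
  have hCs : ∀ n, C (n + 1) = C n ∩ P (C n) := fun n => rfl
  have hCm : ∀ n, MeasurableSet (C n) := by
    intro n
    induction n with
    | zero => exact .univ
    | succ n ih => exact ih.inter (hPm _)
  have hC0 : ∀ n, μ (A ∩ C n) ≠ 0 := by
    intro n
    induction n with
    | zero => simpa [C] using hA
    | succ n ih => rw [hCs, ← inter_assoc]; exact (hP _ ih).1
  have hanti : Antitone C := antitone_nat_of_succ_le fun n => inter_subset_left
  -- The colour is the stage at which a point leaves the decreasing sequence `C`; colour `n`
  -- contains the piece `(A ∩ C n) \ P (C n)`.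
  refine ⟨fun x => sInf {n | x ∈ (C (n + 1))ᶜ}, measurable_sInf_nat fun n => (hCm (n + 1)).compl,
    fun n h => (hP _ (hC0 n)).2 (measure_mono_null ?_ h)⟩
  rintro x ⟨⟨hxA, hxC⟩, hxP⟩
  refine ⟨hxA, le_antisymm (Nat.sInf_le fun h => hxP h.2) ?_⟩
  by_contra! hlt
  exact Nat.sInf_mem (s := {n | x ∈ (C (n + 1))ᶜ}) ⟨n, fun h => hxP h.2⟩ (hanti hlt hxC)

end Saturation

/-! ### Products of labels along paths in a tree. -/

section PathProduct

open Set Filter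

variable {X : Type u} {Λ : Type v} [Group Λ]

/-- There is a path in `G` from the first point to the second along which the product of the labels
`ℓ`, from right to left, is the given group element. -/
inductive PathProduct (ℓ : X → X → Λ) (G : Set (X × X)) : X → X → Λ → Prop
  | refl (x : X) : PathProduct ℓ G x x 1
  | step {x y z : X} {g : Λ} :
      PathProduct ℓ G x y g → (y, z) ∈ G → PathProduct ℓ G x z (ℓ y z * g)

namespace PathProduct

variable {ℓ : X → X → Λ} {G : Set (X × X)}

theorem single {x y : X} (h : (x, y) ∈ G) : PathProduct ℓ G x y (ℓ x y) := by
  simpa using (refl (ℓ := ℓ) x).step h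

theorem trans {x y z : X} {g h : Λ} (hxy : PathProduct ℓ G x y g) (hyz : PathProduct ℓ G y z h) :
    PathProduct ℓ G x z (h * g) := by
  induction hyz with
  | refl => simpa
  | step _ he ih => rw [mul_assoc]; exact ih.step he

theorem symm (hG : ∀ x y, (x, y) ∈ G → (y, x) ∈ G)
    (hℓ : ∀ x y, (x, y) ∈ G → ℓ y x = (ℓ x y)⁻¹) {x y : X} {g : Λ}
    (h : PathProduct ℓ G x y g) : PathProduct ℓ G y x g⁻¹ := by
  induction h with
  | refl => simpa using refl x
  | step _ he ih =>
    rw [mul_inv_rev, ← hℓ _ _ he]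
    exact (single (hG _ _ he)).trans ih

theorem mono {G' : Set (X × X)} (hG : G ⊆ G') {x y : X} {g : Λ} (h : PathProduct ℓ G x y g) :
    PathProduct ℓ G' x y g := by
  induction h with
  | refl => exact refl x
  | step _ he ih => exact ih.step (hG he)

theorem eq_one (hℓ : ∀ x y, (x, y) ∈ G → ℓ x y = 1) {x y : X} {g : Λ}
    (h : PathProduct ℓ G x y g) : g = 1 := by
  induction h with
  | refl => rfl
  | step _ he ih => rw [ih, hℓ _ _ he, one_mul]

theorem exists_of_eqvGen (hG : ∀ x y, (x, y) ∈ G → (y, x) ∈ G)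
    (hℓ : ∀ x y, (x, y) ∈ G → ℓ y x = (ℓ x y)⁻¹) {x y : X}
    (h : Relation.EqvGen (fun p q => (p, q) ∈ G) x y) : ∃ g, PathProduct ℓ G x y g := by
  induction h with
  | rel x y h => exact ⟨_, single h⟩
  | refl x => exact ⟨_, refl x⟩
  | symm x y _ ih => exact ⟨_, ih.choose_spec.symm hG hℓ⟩
  | trans x y z _ _ ih₁ ih₂ => exact ⟨_, ih₁.choose_spec.trans ih₂.choose_spec⟩

/-- Each label is a quotient of consecutive values of `f`, so the product telescopes. In the
application `C` is a class of `R`, the only place where a potential is available. -/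
theorem eq_of_potential {f : X → Λ} {C : Set X} (hC : ∀ x y, (x, y) ∈ G → x ∈ C → y ∈ C)
    (hf : ∀ x y, x ∈ C → (x, y) ∈ G → f y = ℓ x y * f x) {x y : X} {g : Λ} (hx : x ∈ C)
    (h : PathProduct ℓ G x y g) : y ∈ C ∧ g = f y * (f x)⁻¹ := by
  induction h with
  | refl => exact ⟨hx, by simp⟩
  | step _ he ih =>
    refine ⟨hC _ _ he ih.1, ?_⟩
    rw [hf _ _ ih.1 he, ih.2, mul_assoc]

end PathProduct

/-- The product of the labels along a walk, from right to left. -/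
def walkProduct {V : Type*} {T : SimpleGraph V} (ℓ : V → V → Λ) {v w : V} (p : T.Walk v w) : Λ :=
  (p.darts.map fun d => ℓ d.fst d.snd).reverse.prod

/-- An antisymmetric labelling of the edges of a tree is the coboundary of a potential. -/
theorem exists_potential {V : Type*} {T : SimpleGraph V} (hT : T.IsTree) {ℓ : V → V → Λ}
    (hℓ : ∀ v w, T.Adj v w → ℓ w v = (ℓ v w)⁻¹) :
    ∃ f : V → Λ, ∀ v w, T.Adj v w → f w = ℓ v w * f v := by
  classical
  obtain ⟨r⟩ := hT.connected.nonempty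
  choose p hp _ using hT.existsUnique_path r
  -- The potential at `v` is the product along the path from the root `r` to `v`. For adjacent
  -- vertices, one of the two root paths extends the other by the edge between them.
  have hstep : ∀ v w (h : T.Adj v w), v ∈ (p w).support →
      walkProduct ℓ (p w) = ℓ v w * walkProduct ℓ (p v) := by
    intro v w h hv
    rw [hT.isAcyclic.path_concat (hp v) (hp w) h hv]
    simp [walkProduct, SimpleGraph.Walk.darts_concat]
  refine ⟨fun v => walkProduct ℓ (p v), fun v w h => ?_⟩
  by_cases hv : v ∈ (p w).support
  · exact hstep v w h hv
  · have hw := hT.isAcyclic.mem_support_of_ne_mem_support_of_adj_of_isPath (hp v) (hp w) h hv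
    change walkProduct ℓ (p w) = ℓ v w * walkProduct ℓ (p v)
    rw [hstep w v h.symm hw, hℓ v w h, mul_inv_cancel_left]

/-- If the local graph is a tree then path products depend only on the end points. -/
theorem PathProduct.unique {R : Setoid X} {G : Set (X × X)} {ℓ : X → X → Λ} {x y z : X} {g h : Λ}
    (htree : (localGraph R G x).IsTree) (hGR : ∀ y z, R x y → (y, z) ∈ G → R y z)
    (hloop : ∀ y, R x y → (y, y) ∉ G) (hℓ : ∀ y z, (y, z) ∈ G → ℓ z y = (ℓ y z)⁻¹)
    (hG : ∀ x y, (x, y) ∈ G → (y, x) ∈ G)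
    (hxy : R x y) (h₁ : PathProduct ℓ G y z g) (h₂ : PathProduct ℓ G y z h) : g = h := by
  classical
  have hadj : ∀ v w : {y : X // R x y}, (localGraph R G x).Adj v w ↔ (v.1, w.1) ∈ G := by
    intro v w
    rw [localGraph, SimpleGraph.fromRel_adj]
    refine ⟨fun h => h.2.elim id (hG _ _), fun h => ⟨?_, Or.inl h⟩⟩
    rintro rfl
    exact hloop _ v.2 h
  obtain ⟨f, hf⟩ := exists_potential htree (ℓ := fun v w => ℓ v.1 w.1)
    fun v w h => hℓ _ _ ((hadj v w).1 h)
  -- The value `1` off the class of `x` is never used, since paths starting in the class stay there.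
  let F : X → Λ := fun w => if hw : R x w then f ⟨w, hw⟩ else 1
  have hC : ∀ v w, (v, w) ∈ G → v ∈ {y | R x y} → w ∈ {y | R x y} :=
    fun v w he hv => R.trans hv (hGR _ _ hv he)
  have hF : ∀ v w, v ∈ {y | R x y} → (v, w) ∈ G → F w = ℓ v w * F v := by
    intro v w hv he
    have hv' : R x v := hv
    have hw : R x w := hC v w he hv
    simp only [F]
    rw [dif_pos hv', dif_pos hw]
    exact hf ⟨v, hv⟩ ⟨w, hw⟩ ((hadj _ _).2 he)
  rw [(eq_of_potential hC hF hxy h₁).2, (eq_of_potential hC hF hxy h₂).2]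

open Classical in
/-- For Borel data, the pairs with a given path product form an analytic set. -/
theorem PathProduct.analyticSet [TopologicalSpace X] [PolishSpace X] [Countable Λ]
    {ℓ : X → X → Λ} {G : Set (X × X)}
    (hG : ∀ g, AnalyticSet {p : X × X | p ∈ G ∧ ℓ p.1 p.2 = g}) (g : Λ) :
    AnalyticSet {p : X × X | PathProduct ℓ G p.1 p.2 g} := by
  -- `A n g` holds the pairs joined by a path of exactly `n` edges with product `g`: after a prefix
  -- with product `h`, the last edge must carry `g * h⁻¹`.
  let A : ℕ → Λ → Set (X × X) := fun n => Nat.rec (fun g => if g = 1 then Set.diagonal X else ∅)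
    (fun _ A g => ⋃ h : Λ, {p | ∃ y, (p.1, y) ∈ A h ∧
      (y, p.2) ∈ {q : X × X | q ∈ G ∧ ℓ q.1 q.2 = g * h⁻¹}}) n
  have hAs : ∀ n g, A (n + 1) g = ⋃ h : Λ, {p | ∃ y, (p.1, y) ∈ A n h ∧
      (y, p.2) ∈ {q : X × X | q ∈ G ∧ ℓ q.1 q.2 = g * h⁻¹}} := fun _ _ => rfl
  have hA0 : ∀ g, A 0 g = if g = 1 then Set.diagonal X else ∅ := fun _ => rfl
  have hA : ∀ n g, AnalyticSet (A n g) := by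
    intro n
    induction n with
    | zero =>
      intro g
      rw [hA0]
      split_ifs
      · exact isClosed_diagonal.analyticSet
      · exact analyticSet_empty
    | succ n ih =>
      intro g
      rw [hAs]
      refine .iUnion fun h => ?_
      have : {p : X × X | ∃ y, (p.1, y) ∈ A n h ∧
          (y, p.2) ∈ {q : X × X | q ∈ G ∧ ℓ q.1 q.2 = g * h⁻¹}} =
          (fun q : X × X × X => (q.1, q.2.2)) '' ((fun q : X × X × X => (q.1, q.2.1)) ⁻¹' A n h ∩
            Prod.snd ⁻¹' {q : X × X | q ∈ G ∧ ℓ q.1 q.2 = g * h⁻¹}) := by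
        ext ⟨x, z⟩
        constructor
        · rintro ⟨y, h1, h2⟩
          exact ⟨(x, y, z), ⟨h1, h2⟩, rfl⟩
        · rintro ⟨⟨x, y, z⟩, ⟨h1, h2⟩, h⟩
          obtain ⟨rfl, rfl⟩ := Prod.ext_iff.1 h
          exact ⟨y, h1, h2⟩
      rw [this]
      exact (analyticSet_inter ((ih h).preimage (by fun_prop))
        ((hG _).preimage continuous_snd)).image_of_continuous (by fun_prop)
  have : {p : X × X | PathProduct ℓ G p.1 p.2 g} = ⋃ n, A n g := by
    ext ⟨x, z⟩
    constructor
    · intro h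
      change PathProduct ℓ G x z g at h
      induction h with
      | refl => exact mem_iUnion.2 ⟨0, by rw [hA0, if_pos rfl]; rfl⟩
      | @step y z g _ he ih =>
        obtain ⟨n, hn⟩ := mem_iUnion.1 ih
        refine mem_iUnion.2 ⟨n + 1, ?_⟩
        rw [hAs]
        exact mem_iUnion.2 ⟨g, y, hn, he, by simp⟩
    · intro h
      obtain ⟨n, hn⟩ := mem_iUnion.1 h
      change PathProduct ℓ G x z g
      clear h
      induction n generalizing z g with
      | zero =>
        rw [hA0] at hn
        split_ifs at hn with hg
        · obtain rfl : x = z := hn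
          exact hg ▸ refl x
        · exact absurd hn (notMem_empty _)
      | succ n ih =>
        rw [hAs] at hn
        obtain ⟨h, y, h1, he, hl⟩ := mem_iUnion.1 hn
        have := (ih h y h1).step he
        rwa [show ℓ y z = g * h⁻¹ from hl, inv_mul_cancel_right] at this
  rw [this]
  exact .iUnion fun n => hA n g

end PathProduct

/-! ### The cocycle obtained from nested treeings. -/

section Cocycle

open Set Filter

variable {X : Type u} [MeasurableSpace X] [StandardBorelSpace X] {μ : Measure X}
  [IsProbabilityMeasure μ] {R S : Setoid X}

/-- If a treeing of `S` is contained in a treeing of `R`, and `S` differs from `R`, then the new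
edges that increase an injective Borel function have a source of positive measure. -/
theorem measure_fst_image_ne_zero (hR : MeasurableSet (graph R)) (hpmp : IsMeasurePreserving μ R)
    (hne : ¬ ∀ᵐ x ∂μ, ∀ y, R x y → S x y) {GS GR : Set (X × X)} (hGS : IsGraphing μ S GS)
    (hGR : IsGraphing μ R GR) {ν : X → ℝ} (hν : Function.Injective ν) :
    μ (Prod.fst '' {p : X × X | p ∈ GR ∧ p ∉ GS ∧ ν p.1 < ν p.2}) ≠ 0 := by
  intro h0
  refine hne ?_
  have hae := (hGR.generates.and hGS.generates).and (measure_eq_zero_iff_ae_notMem.1 h0)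
  obtain ⟨W, -, hW, hinv, hp⟩ := exists_saturated_conull hR hpmp hae
  filter_upwards [hW] with x hx y hxy
  -- Membership in `W` is carried through the induction, since the intermediate points must be good
  -- as well. An edge outside `GS` would increase `ν` in one direction, making one of its ends a
  -- source in the null set.
  have key : ∀ p q, Relation.EqvGen (fun p q => (p, q) ∈ GR) p q → (p ∈ W ↔ q ∈ W) ∧
      (p ∈ W → S p q) := by
    intro p q h
    induction h with
    | rel p q h =>
      have hpq : p ∈ W ↔ q ∈ W := by
        constructor
        · intro hpW
          exact (hinv p q (((hp p hpW).1.1 q).2 (.rel _ _ h))).1 hpW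
        · intro hqW
          exact (hinv q p (((hp q hqW).1.1 p).2 (.rel _ _ (hGR.symm _ _ h)))).1 hqW
      refine ⟨hpq, fun hpW => ?_⟩
      by_cases hs : (p, q) ∈ GS
      · exact ((hp p hpW).1.2 q).2 (.rel _ _ hs)
      · rcases lt_trichotomy (ν p) (ν q) with hlt | heq | hlt
        · exact absurd ⟨(p, q), ⟨h, hs, hlt⟩, rfl⟩ (hp p hpW).2
        · exact hν heq ▸ S.refl p
        · exact absurd ⟨(q, p), ⟨hGR.symm _ _ h, fun hs' => hs (hGS.symm _ _ hs'), hlt⟩, rfl⟩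
            (hp q (hpq.1 hpW)).2
    | refl p => exact ⟨Iff.rfl, fun _ => S.refl p⟩
    | symm p q _ ih => exact ⟨ih.1.symm, fun h => S.symm (ih.2 (ih.1.2 h))⟩
    | trans p q r _ _ ih₁ ih₂ =>
      exact ⟨ih₁.1.trans ih₂.1, fun h => S.trans (ih₁.2 h) (ih₂.2 (ih₁.1.1 h))⟩
  exact (key x y (((hp x hx).1.1 y).1 hxy)).2 hx

/-- If the ergodic relation `S` is primitive in `R` and proper, then there is a Borel cocycle of `R`,
defined on a saturated conull set `W`, that is trivial on `S` and class-surjective. -/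
theorem exists_cocycle (Λ : Type v) [Group Λ] [Countable Λ] (hR : IsDiscreteBorel R)
    (hpmp : IsMeasurePreserving μ R) (hSR : IsSubrelation S R) (hS : IsErgodic μ S)
    (hprim : IsPrimitive μ S R) (hne : ¬ ∀ᵐ x ∂μ, ∀ y, R x y → S x y) :
    ∃ (θ : X → X → Λ) (W : Set X), MeasurableSet W ∧ (∀ᵐ x ∂μ, x ∈ W) ∧
      (∀ x y, R x y → (x ∈ W ↔ y ∈ W)) ∧
      (∀ g, MeasurableSet {p : X × X | (R p.1 p.2 ∧ p.1 ∈ W) ∧ θ p.1 p.2 = g}) ∧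
      (∀ x ∈ W, ∀ y z, R x y → R y z → θ x z = θ y z * θ x y) ∧
      (∀ x ∈ W, ∀ y, S x y → θ x y = 1) ∧ ∀ x ∈ W, ∀ g, ∃ y, R x y ∧ θ x y = g := by
  classical
  obtain ⟨GS, GR, hGS, hGR, hsub⟩ := hprim
  obtain ⟨ν, hν⟩ := exists_measurableEmbedding_real X
  have hlt : MeasurableSet {p : X × X | ν p.1 < ν p.2} :=
    measurableSet_lt (hν.measurable.comp measurable_fst) (hν.measurable.comp measurable_snd)
  have hgt : MeasurableSet {p : X × X | ν p.2 < ν p.1} :=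
    measurableSet_lt (hν.measurable.comp measurable_snd) (hν.measurable.comp measurable_fst)
  have hD0 := measure_fst_image_ne_zero hR.measurableSet_graph hpmp hne hGS.toIsGraphing
    hGR.toIsGraphing hν.injective
  obtain ⟨A, hAD, hAm, hA⟩ := (nullMeasurableSet_fst_image μ (hGR.measurableSet.inter
    (hGS.measurableSet.compl.inter hlt))).exists_measurable_subset_ae_eq
  have hA0 : μ A ≠ 0 := by rw [measure_congr hA]; exact hD0
  obtain ⟨c, hc, hcA⟩ := exists_measurable_nat_coloring
    (hS.measure_singleton_eq_zero hR hpmp hSR hne) hA0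
  obtain ⟨e, he⟩ := exists_injective_nat Λ
  let _ : MeasurableSpace Λ := ⊤
  have : DiscreteMeasurableSpace Λ := ⟨fun _ => trivial⟩
  -- Colour `e g` is decoded to `g`, so every `g` is the value of `k` on a subset of `A` of positive
  -- measure.
  let k : X → Λ := fun x => Function.invFun e (c x)
  have hk : Measurable k := (Measurable.of_discrete (f := Function.invFun e)).comp hc
  -- `ν` orients each new edge, and the edge takes its label from its lower end point; the last `1`
  -- only concerns `x = y`.
  let ℓ : X → X → Λ := fun x y => if (x, y) ∈ GS then 1 else if ν x < ν y then k x else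
    if ν y < ν x then (k y)⁻¹ else 1
  have hℓm : Measurable fun p : X × X => ℓ p.1 p.2 :=
    Measurable.ite hGS.measurableSet measurable_const
      (Measurable.ite hlt (hk.comp measurable_fst)
        (Measurable.ite hgt ((Measurable.of_discrete (f := fun g : Λ => g⁻¹)).comp
          (hk.comp measurable_snd)) measurable_const))
  have hℓS : ∀ x y, (x, y) ∈ GS → ℓ x y = 1 := fun x y h => if_pos h
  have hℓinv : ∀ x y, ℓ y x = (ℓ x y)⁻¹ := by
    intro x y
    by_cases hs : (x, y) ∈ GS
    · rw [hℓS _ _ hs, hℓS _ _ (hGS.symm _ _ hs), inv_one]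
    · have hs' : (y, x) ∉ GS := fun h => hs (hGS.symm _ _ h)
      simp only [ℓ, if_neg hs, if_neg hs']
      rcases lt_trichotomy (ν x) (ν y) with h | h | h
      · rw [if_neg h.not_gt, if_pos h, if_pos h]
      · simp [h]
      · rw [if_pos h, if_neg h.not_gt, if_pos h, inv_inv]
  have hhit : ∀ᵐ x ∂μ, ∀ g, x ∈ saturation S (A ∩ c ⁻¹' {e g}) := ae_all_iff.2 fun g =>
    hS.ae_mem_saturation hR.measurableSet_graph hpmp hSR
      (hAm.inter (hc (measurableSet_singleton _))) (hcA _)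
  obtain ⟨W, hWm, hW, hWinv, hWp⟩ := exists_saturated_conull hR.measurableSet_graph hpmp
    (hGR.generates.and (hGS.generates.and (hGR.no_loops.and (hGR.isTree.and hhit))))
  have hex : ∀ x y, x ∈ W → R x y → ∃ g, PathProduct ℓ GR x y g := fun x y hx hxy =>
    PathProduct.exists_of_eqvGen hGR.symm (fun x y _ => hℓinv x y) (((hWp x hx).1 y).1 hxy)
  have huniq : ∀ x y g h, x ∈ W → PathProduct ℓ GR x y g → PathProduct ℓ GR x y h → g = h := by
    intro x y g h hx h₁ h₂
    have hy : ∀ {y}, R x y → y ∈ W := fun h => (hWinv x _ h).1 hx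
    exact PathProduct.unique (hWp x hx).2.2.2.1
      (fun y z hxy hyz => ((hWp y (hy hxy)).1 z).2 (.rel _ _ hyz))
      (fun y hxy => (hWp y (hy hxy)).2.2.1) (fun y z _ => hℓinv y z) hGR.symm (R.refl x) h₁ h₂
  -- From points of `W` to their `R`-class a product exists because `GR` generates `R`, and is
  -- unique because the local graph is a tree.
  let θ : X → X → Λ := fun x y => if h : ∃ g, PathProduct ℓ GR x y g then h.choose else 1
  have hθ : ∀ x y g, x ∈ W → PathProduct ℓ GR x y g → θ x y = g := by
    intro x y g hx h
    have h' : ∃ g, PathProduct ℓ GR x y g := ⟨g, h⟩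
    simp only [θ, dif_pos h']
    exact huniq x y _ _ hx h'.choose_spec h
  have hθ' : ∀ x y, x ∈ W → R x y → PathProduct ℓ GR x y (θ x y) := by
    intro x y hx hxy
    obtain ⟨g, hg⟩ := hex x y hx hxy
    rwa [hθ x y g hx hg]
  refine ⟨θ, W, hWm, hW, hWinv, ?_, ?_, ?_, ?_⟩
  · let _ := upgradeStandardBorel X
    have hRW : MeasurableSet {p : X × X | R p.1 p.2 ∧ p.1 ∈ W} :=
      hR.measurableSet_graph.inter (measurable_fst hWm)
    have han : ∀ g, AnalyticSet {p : X × X | (R p.1 p.2 ∧ p.1 ∈ W) ∧ θ p.1 p.2 = g} := by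
      intro g
      have heq : {p : X × X | (R p.1 p.2 ∧ p.1 ∈ W) ∧ θ p.1 p.2 = g} =
          {p : X × X | R p.1 p.2 ∧ p.1 ∈ W} ∩ {p | PathProduct ℓ GR p.1 p.2 g} := by
        ext ⟨x, y⟩
        constructor
        · rintro ⟨⟨h1, h2⟩, h3⟩
          exact ⟨⟨h1, h2⟩, h3 ▸ hθ' x y h2 h1⟩
        · rintro ⟨⟨h1, h2⟩, h3⟩
          exact ⟨⟨h1, h2⟩, hθ x y g h2 h3⟩
      rw [heq]
      exact analyticSet_inter hRW.analyticSet (PathProduct.analyticSet (fun g =>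
        (hGR.measurableSet.inter (hℓm (measurableSet_singleton g))).analyticSet) g)
    intro g
    -- Suslin's theorem: the complement is a countable union of the other fibres and a Borel set,
    -- hence also analytic.
    refine (han g).measurableSet_of_compl ?_
    have heq : {p : X × X | (R p.1 p.2 ∧ p.1 ∈ W) ∧ θ p.1 p.2 = g}ᶜ =
        ⋃ h : Option {h : Λ // h ≠ g}, h.elim {p : X × X | R p.1 p.2 ∧ p.1 ∈ W}ᶜ
          fun h => {p : X × X | (R p.1 p.2 ∧ p.1 ∈ W) ∧ θ p.1 p.2 = h} := by
      ext p
      simp only [mem_compl_iff, mem_ofPred_eq, iUnion_option, Option.elim, mem_union, mem_iUnion]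
      constructor
      · intro h
        by_cases h' : R p.1 p.2 ∧ p.1 ∈ W
        · exact Or.inr ⟨⟨θ p.1 p.2, fun e => h ⟨h', e⟩⟩, h', rfl⟩
        · exact Or.inl h'
      · rintro (h | ⟨i, -, h⟩) ⟨h1, h2⟩
        · exact h h1
        · exact i.2 (h.symm.trans h2)
    rw [heq]
    refine .iUnion fun h => ?_
    cases h with
    | none => exact hRW.compl.analyticSet
    | some h => exact han h
  · intro x hx y z hxy hyz
    exact hθ _ _ _ hx ((hθ' x y hx hxy).trans (hθ' y z ((hWinv x y hxy).1 hx) hyz))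
  · intro x hx y hxy
    obtain ⟨g, hg⟩ := PathProduct.exists_of_eqvGen (ℓ := ℓ) hGS.symm (fun x y _ => hℓinv x y)
      (((hWp x hx).2.1 y).1 hxy)
    rw [hθ x y g hx (hg.mono hsub), hg.eq_one hℓS]
  · intro x hx g
    -- Travel inside the `S`-class, with product `1`, to a source coloured `e g`, then cross a new
    -- edge labelled `g`.
    obtain ⟨z, ⟨hzA, hzc⟩, hxz⟩ := (hWp x hx).2.2.2.2 g
    obtain ⟨⟨z', y⟩, ⟨hG, hs, hzy⟩, hz'⟩ := hAD hzA
    obtain rfl : z' = z := hz'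
    have hxz' : PathProduct ℓ GS x z' 1 := by
      obtain ⟨h, hh⟩ := PathProduct.exists_of_eqvGen (ℓ := ℓ) hGS.symm (fun x y _ => hℓinv x y)
        (((hWp x hx).2.1 z').1 hxz)
      exact hh.eq_one hℓS ▸ hh
    have hzW : z' ∈ W := (hWinv x z' (hSR.le _ _ hxz)).1 hx
    refine ⟨y, R.trans (hSR.le _ _ hxz) (((hWp z' hzW).1 y).2 (.rel _ _ hG)), ?_⟩
    rw [hθ x y _ hx ((hxz'.mono hsub).step hG), mul_one]
    simp only [ℓ]
    rw [if_neg hs, if_pos (show ν z' < ν y from hzy)]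
    change Function.invFun e (c z') = g
    rw [show c z' = e g from hzc]
    exact Function.leftInverse_invFun he g

/-- A class-surjective Borel family of pairs has a Borel choice function for each value. -/
theorem exists_measurable_choice {Λ : Type v} {W : Set X} {θ : X → X → Λ}
    (hW : ∀ᵐ x ∂μ, x ∈ W)
    (hm : ∀ g, MeasurableSet {p : X × X | (R p.1 p.2 ∧ p.1 ∈ W) ∧ θ p.1 p.2 = g})
    (hsurj : ∀ x ∈ W, ∀ g, ∃ y, R x y ∧ θ x y = g) (g : Λ) :
    ∃ φ : X → X, Measurable φ ∧ ∀ᵐ x ∂μ, R x (φ x) ∧ θ x (φ x) = g := by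
  let _ := upgradeStandardBorel X
  obtain ⟨φ, hφ, hE⟩ := exists_measurable_selection μ (hm g).analyticSet (by
    filter_upwards [hW] with x hx
    obtain ⟨y, hy, hg⟩ := hsurj x hx g
    exact ⟨y, ⟨hy, hx⟩, hg⟩)
  exact ⟨φ, hφ, hE.mono fun x hx => ⟨hx.1.1, hx.2⟩⟩

end Cocycle

/-! ### The kernel of a cocycle and the quotient by it. -/

section Kernel

open Set Filter

variable {X : Type u} {R : Setoid X} {Λ : Type v} [Group Λ] {W : Set X} {θ : X → X → Λ}

/-- A cocycle of `R` with values in a group, on a saturated set `W`. -/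
structure IsCocycleOn (R : Setoid X) (W : Set X) (θ : X → X → Λ) : Prop where
  mem_iff : ∀ x y, R x y → (x ∈ W ↔ y ∈ W)
  map_mul : ∀ x ∈ W, ∀ y z, R x y → R y z → θ x z = θ y z * θ x y

namespace IsCocycleOn

theorem map_self (h : IsCocycleOn R W θ) {x : X} (hx : x ∈ W) : θ x x = 1 := by
  simpa using h.map_mul x hx x x (R.refl x) (R.refl x)

theorem map_swap (h : IsCocycleOn R W θ) {x y : X} (hx : x ∈ W) (hxy : R x y) :
    θ y x = (θ x y)⁻¹ :=
  eq_inv_of_mul_eq_one_left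
    ((h.map_mul x hx y x hxy (R.symm hxy)).symm.trans (h.map_self hx))

/-- The kernel of a cocycle on `W`, trivial outside `W`. -/
def kernel (h : IsCocycleOn R W θ) : Setoid X where
  r x y := x = y ∨ ((R x y ∧ x ∈ W) ∧ θ x y = 1)
  iseqv :=
    { refl := fun _ => Or.inl rfl
      symm := by
        rintro x y (rfl | ⟨⟨hR, hx⟩, hθ⟩)
        · exact Or.inl rfl
        · exact Or.inr ⟨⟨R.symm hR, (h.mem_iff x y hR).1 hx⟩, by
            rw [h.map_swap hx hR, hθ, inv_one]⟩
      trans := by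
        rintro x y z (rfl | ⟨⟨hR, hx⟩, hθ⟩) hyz
        · exact hyz
        · rcases hyz with rfl | ⟨⟨hR', hy⟩, hθ'⟩
          · exact Or.inr ⟨⟨hR, hx⟩, hθ⟩
          · exact Or.inr ⟨⟨R.trans hR hR', hx⟩, by
              rw [h.map_mul x hx y z hR hR', hθ, hθ', one_mul]⟩ }

theorem kernel_le (h : IsCocycleOn R W θ) {x y : X} (hxy : h.kernel x y) : R x y := by
  rcases hxy with rfl | hxy
  exacts [R.refl x, hxy.1.1]

theorem kernel_iff (h : IsCocycleOn R W θ) {x y : X} (hx : x ∈ W) (hxy : R x y) :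
    h.kernel x y ↔ θ x y = 1 := by
  constructor
  · rintro (rfl | h')
    exacts [h.map_self hx, h'.2]
  · exact fun h' => Or.inr ⟨⟨hxy, hx⟩, h'⟩

/-- By `θ x z = θ y z * θ x y`. Thus the kernel classes inside the `R`-class of `x` are the fibres
of `θ x`, indexed by the values it takes. -/
theorem kernel_iff_eq (h : IsCocycleOn R W θ) {x y z : X} (hx : x ∈ W) (hxy : R x y)
    (hxz : R x z) : h.kernel y z ↔ θ x y = θ x z := by
  have hyz := R.trans (R.symm hxy) hxz
  rw [h.kernel_iff ((h.mem_iff x y hxy).1 hx) hyz, h.map_mul x hx y z hxy hyz, eq_comm (a := θ x y),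
    mul_eq_right]

end IsCocycleOn

variable [MeasurableSpace X] {μ : Measure X}

namespace IsCocycleOn

theorem isSubrelation_kernel [StandardBorelSpace X] (h : IsCocycleOn R W θ)
    (hm : ∀ g, MeasurableSet {p : X × X | (R p.1 p.2 ∧ p.1 ∈ W) ∧ θ p.1 p.2 = g}) :
    IsSubrelation h.kernel R where
  measurableSet_graph := measurableSet_diagonal.union (hm 1)
  le _ _ := h.kernel_le

/-- On `W` the kernel contains `S`, so a kernel-saturated set cut down to `W` is `S`-saturated. -/
theorem isErgodic_kernel (h : IsCocycleOn R W θ) (hWm : MeasurableSet W) (hW : ∀ᵐ x ∂μ, x ∈ W)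
    {S : Setoid X} (hSR : ∀ x y, S x y → R x y) (hS : IsErgodic μ S)
    (hθS : ∀ x ∈ W, ∀ y, S x y → θ x y = 1) : IsErgodic μ h.kernel := by
  intro A hA hinv
  have hAW : A =ᵐ[μ] (A ∩ W : Set X) := by
    filter_upwards [hW] with x hx
    exact propext ⟨fun h => ⟨h, hx⟩, And.left⟩
  rw [measure_congr hAW]
  refine hS _ (hA.inter hWm) fun x y hxy => ?_
  have hWxy := h.mem_iff x y (hSR x y hxy)
  by_cases hx : x ∈ W
  · have := hinv x y ((h.kernel_iff hx (hSR x y hxy)).2 (hθS x hx y hxy))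
    exact and_congr this hWxy
  · exact ⟨fun h => absurd h.2 hx, fun h => absurd (hWxy.2 h.2) hx⟩

variable [StandardBorelSpace X] [IsProbabilityMeasure μ]

/-- `φ g` selects a point of the fibre over `g`. Moving `x` within its kernel class does not change
that fibre, so `φ g` preserves the kernel. -/
theorem isNormal_kernel [Countable Λ] (h : IsCocycleOn R W θ) (hR : MeasurableSet (graph R))
    (hpmp : IsMeasurePreserving μ R) (hW : ∀ᵐ x ∂μ, x ∈ W) {φ : Λ → X → X}
    (hφ : ∀ g, Measurable (φ g)) (hφθ : ∀ᵐ x ∂μ, ∀ g, R x (φ g x) ∧ θ x (φ g x) = g) :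
    IsNormal μ h.kernel R := by
  -- The index type of a choice family lives in `Type`; a countable `Λ` is small enough to be moved
  -- there.
  let e := equivShrink.{0} Λ
  have hJ : Countable (Shrink.{0} Λ) := e.symm.injective.countable
  refine ⟨Shrink.{0} Λ, hJ, fun j => φ (e.symm j), ⟨fun j => hφ _, ?_, ?_⟩, ?_⟩
  · filter_upwards [hφθ] with x hx j
    exact (hx _).1
  · filter_upwards [hφθ, hW] with x hx hxW y hxy
    refine ⟨e (θ x y), ?_, fun j hj => ?_⟩
    · refine (h.kernel_iff_eq hxW (hx _).1 hxy).2 ?_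
      rw [(hx _).2, Equiv.symm_apply_apply]
    · have := (h.kernel_iff_eq hxW (hx _).1 hxy).1 hj
      rw [(hx _).2] at this
      rw [← this, Equiv.apply_symm_apply]
  · filter_upwards [ae_forall_rel hR hpmp hφθ, hW] with x hx hxW j y hxy
    have hRxy := h.kernel_le hxy
    have h1 := hx x (R.refl x) (e.symm j)
    have h2 := hx y hRxy (e.symm j)
    refine (h.kernel_iff_eq hxW h1.1 (R.trans hRxy h2.1)).2 ?_
    rw [h.map_mul x hxW _ _ hRxy h2.1, h1.2, h2.2, (h.kernel_iff hxW hRxy).1 hxy, mul_one]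

end IsCocycleOn

/-- Object values that agree only propositionally make hom-sets incomparable; comparing in `Arrow`
avoids casts. -/
theorem arrow_mk_comp_congr {C : Type*} [Category C] {x y z x' y' z' : C} {f : x ⟶ y} {g : y ⟶ z}
    {f' : x' ⟶ y'} {g' : y' ⟶ z'} (hf : Arrow.mk f = Arrow.mk f') (hg : Arrow.mk g = Arrow.mk g') :
    Arrow.mk (f ≫ g) = Arrow.mk (f' ≫ g') := by
  obtain rfl : x = x' := congrArg (fun F : Arrow C => F.left) hf
  obtain rfl : y = y' := congrArg (fun F : Arrow C => F.right) hf
  obtain rfl : z = z' := congrArg (fun F : Arrow C => F.right) hg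
  rw [Arrow.mk_injective _ _ hf, Arrow.mk_injective _ _ hg]

theorem arrow_mk_eqToHom {C : Type*} [Category C] {x y : C} (h : x = y) :
    Arrow.mk (eqToHom h) = Arrow.mk (𝟙 x) := by
  subst h; rfl

theorem arrow_mk_eqToHom' {C : Type*} [Category C] {x y : C} (h : x = y) :
    Arrow.mk (eqToHom h) = Arrow.mk (𝟙 y) := by
  subst h; rfl

theorem exists_endo_of_arrow {C : Type*} [Category C] {F : Arrow C} {o : C} (hl : F.left = o)
    (hr : F.right = o) : ∃ k : o ⟶ o, Arrow.mk k = F := by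
  subst hl
  obtain ⟨k, hk⟩ : ∃ k : F.left ⟶ F.left, Arrow.mk k = F := by
    refine ⟨F.hom ≫ eqToHom hr, ?_⟩
    have h1 := arrow_mk_comp_congr (f := F.hom) (g := eqToHom hr) (g' := 𝟙 _) rfl
      (arrow_mk_eqToHom hr)
    rw [h1, Category.comp_id]
    rfl
  exact ⟨k, hk⟩

variable [StandardBorelSpace X] [IsProbabilityMeasure μ] [Countable Λ]

open Classical in
/-- A Borel cocycle on a conull set, as a homomorphism to a groupoid with one object. -/
noncomputable def IsCocycleOn.relHom (h : IsCocycleOn R W θ)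
    (hWm : MeasurableSet W) (hW : ∀ᵐ x ∂μ, x ∈ W)
    (hm : ∀ g, MeasurableSet {p : X × X | (R p.1 p.2 ∧ p.1 ∈ W) ∧ θ p.1 p.2 = g}) :
    RelHom μ R (ofGroup Λ) where
  obj _ := SingleObj.star Λ
  map x y _ := (if x ∈ W then θ x y else 1 : Λ)
  measurable_obj := measurable_const
  measurable_map := by
    let _ : MeasurableSpace Λ := ⊤
    have h1 : Measurable fun p : {p : X × X // R p.1 p.2} =>
        (if p.1.1 ∈ W then θ p.1.1 p.1.2 else 1 : Λ) := by
      refine measurable_to_countable' fun g => ?_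
      have h2 : (fun p : {p : X × X // R p.1 p.2} =>
          (if p.1.1 ∈ W then θ p.1.1 p.1.2 else 1 : Λ)) ⁻¹' {g} = Subtype.val ⁻¹'
          ({p : X × X | (R p.1 p.2 ∧ p.1 ∈ W) ∧ θ p.1 p.2 = g} ∪
            (Prod.fst ⁻¹' Wᶜ ∩ {_p | g = 1})) := by
        ext ⟨⟨x, y⟩, hxy⟩
        by_cases hx : x ∈ W
        · simp [hx, show R x y from hxy]
        · simp [hx, eq_comm]
      rw [h2]
      exact measurable_subtype_coe
        ((hm g).union ((measurable_fst hWm.compl).inter (.const _)))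
    have h3 : @Measurable Λ (Arrow (SingleObj Λ)) ⊤ (ofGroup Λ).measurableArrow
        fun g => Arrow.mk (show SingleObj.star Λ ⟶ SingleObj.star Λ from g) := fun _ _ => trivial
    exact h3.comp h1
  map_comp := by
    filter_upwards [hW] with x hx y z hxy hyz
    -- In `SingleObj Λ`, `f ≫ g` is `g * f`; hence the right-to-left convention for products.
    change (if x ∈ W then θ x z else 1 : Λ) =
      (if y ∈ W then θ y z else 1 : Λ) * (if x ∈ W then θ x y else 1 : Λ)
    rw [if_pos hx, if_pos hx, if_pos ((h.mem_iff x y hxy).1 hx), h.map_mul x hx y z hxy hyz]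

/-- Homomorphisms that are trivial on an ergodic kernel factor through the cocycle. -/
theorem IsCocycleOn.exists_factor (h : IsCocycleOn R W θ) (hR : MeasurableSet (graph R))
    (hpmp : IsMeasurePreserving μ R) (hW : ∀ᵐ x ∂μ, x ∈ W) (herg : IsErgodic μ h.kernel)
    {φ : Λ → X → X} (hφ : ∀ g, Measurable (φ g))
    (hφθ : ∀ᵐ x ∂μ, ∀ g, R x (φ g x) ∧ θ x (φ g x) = g)
    (H : BorelGroupoid.{a, b}) (θ' : RelHom μ R H)
    (hker : ∀ᵐ x ∂μ, ∀ y (hxy : R x y), h.kernel x y → θ'.InKernel x y hxy) :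
    ∃ κ : GroupoidHom (ofGroup Λ) H, ∀ᵐ x ∂μ, ∀ y (hxy : R x y),
      Arrow.mk (κ.functor.map (show SingleObj.star Λ ⟶ SingleObj.star Λ from θ x y)) =
        Arrow.mk (θ'.map x y hxy) := by
  classical
  obtain ⟨V, -, hV, hVinv, hVp⟩ := exists_saturated_conull hR hpmp
    (hW.and (hφθ.and (θ'.map_comp.and hker)))
  have hkerL : ∀ x ∈ V, ∀ y, (hxy : R x y) → h.kernel x y → θ'.obj x = θ'.obj y ∧
      Arrow.mk (θ'.map x y hxy) = Arrow.mk (𝟙 (θ'.obj x)) ∧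
      Arrow.mk (θ'.map x y hxy) = Arrow.mk (𝟙 (θ'.obj y)) := by
    intro x hx y hxy hN
    obtain ⟨e, he⟩ := (hVp x hx).2.2.2 y hxy hN
    rw [he]
    exact ⟨e, arrow_mk_eqToHom e, arrow_mk_eqToHom' e⟩
  have hkey : ∀ x ∈ V, ∀ y z (hxy : R x y) (hxz : R x z), θ x y = θ x z →
      Arrow.mk (θ'.map x y hxy) = Arrow.mk (θ'.map x z hxz) := by
    intro x hx y z hxy hxz he
    have hyz := R.trans (R.symm hxy) hxz
    have hN := (h.kernel_iff_eq (hVp x hx).1 hxy hxz).2 he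
    have := hkerL y ((hVinv x y hxy).1 hx) z hyz hN
    rw [(hVp x hx).2.2.1 y z hxy hyz,
      arrow_mk_comp_congr (f := θ'.map x y hxy) rfl this.2.1, Category.comp_id]
  have hkey' : ∀ x ∈ V, ∀ y z (hxy : R x y) (hyz : R y z), h.kernel x y →
      Arrow.mk (θ'.map x z (R.trans hxy hyz)) = Arrow.mk (θ'.map y z hyz) := by
    intro x hx y z hxy hyz hN
    have := hkerL x hx y hxy hN
    rw [(hVp x hx).2.2.1 y z hxy hyz,
      arrow_mk_comp_congr (g := θ'.map y z hyz) this.2.2 rfl, Category.id_comp]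
  -- `F g x` is the value of `θ'` on a pair from `x` with `θ`-value `g`. The unit arrow is a filler
  -- on a null set.
  let F : Λ → X → Arrow H.Ob := fun g x =>
    if hx : x ∈ {x | R x (φ g x)} then Arrow.mk (θ'.map x (φ g x) hx) else Arrow.mk (𝟙 (θ'.obj x))
  have hFm : ∀ g, Measurable (F g) := by
    intro g
    have hs : MeasurableSet {x | R x (φ g x)} := (measurable_id.prodMk (hφ g)) hR
    refine Measurable.dite (s := {x | R x (φ g x)})
      (f := fun x => Arrow.mk (θ'.map x.1 (φ g x.1) x.2))
      (g := fun x => Arrow.mk (𝟙 (θ'.obj x.1))) ?_ ?_ hs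
    · exact θ'.measurable_map.comp (Measurable.subtype_mk
        (f := fun x : {x | R x (φ g x)} => (x.1, φ g x.1)) (h := fun x => x.2)
        (measurable_subtype_coe.prodMk ((hφ g).comp measurable_subtype_coe)))
    · exact (H.measurable_id.comp θ'.measurable_obj).comp measurable_subtype_coe
  have hFval : ∀ g x (hx : R x (φ g x)), F g x = Arrow.mk (θ'.map x (φ g x) hx) :=
    fun g x hx => dif_pos hx
  -- By `hkey'` and `hkey`, `F g` is invariant under the kernel, so ergodicity makes it constant; `A
  -- g` is the future image of `g`.
  have hFinv : ∀ g, ∃ A, ∀ᵐ x ∂μ, F g x = A := by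
    intro g
    refine herg.exists_ae_eq_const hR hpmp (fun _ _ => h.kernel_le) (hFm g) ?_
    filter_upwards [hV] with x hx y hN
    have hxy := h.kernel_le hN
    have hy := (hVinv x y hxy).1 hx
    have h1 := (hVp x hx).2.1 g
    have h2 := (hVp y hy).2.1 g
    rw [hFval g x h1.1, hFval g y h2.1, ← hkey' x hx y _ hxy h2.1 hN]
    refine hkey x hx _ _ _ _ ?_
    rw [h.map_mul x (hVp x hx).1 y _ hxy h2.1, h1.2, h2.2,
      (h.kernel_iff (hVp x hx).1 hxy).1 hN, mul_one]
  choose A hA using hFinv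
  obtain ⟨o, ho⟩ := herg.exists_ae_eq_const hR hpmp (fun _ _ => h.kernel_le) θ'.measurable_obj (by
    filter_upwards [hV] with x hx y hN
    exact (hkerL x hx y (h.kernel_le hN) hN).1)
  obtain ⟨U, -, hU, hUinv, hUp⟩ := exists_saturated_conull hR hpmp
    (hV.and (ho.and (ae_all_iff.2 hA)))
  have hval : ∀ x ∈ U, ∀ y (hxy : R x y) g, θ x y = g → Arrow.mk (θ'.map x y hxy) = A g := by
    intro x hx y hxy g hg
    have h1 := (hVp x (hUp x hx).1).2.1 g
    rw [← (hUp x hx).2.2, hFval _ x h1.1]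
    exact hkey x (hUp x hx).1 _ _ _ _ (hg.trans h1.2.symm)
  -- The group laws for the constants can be read off at a single good point.
  obtain ⟨x, hx⟩ := hU.exists
  have hφx := (hVp x (hUp x hx).1).2.1
  have hxW := (hVp x (hUp x hx).1).1
  have hend : ∀ g, ∃ k : o ⟶ o, Arrow.mk k = A g := by
    intro g
    have h1 := hφx g
    rw [← hval x hx _ h1.1 g h1.2]
    exact exists_endo_of_arrow (hUp x hx).2.1 (hUp _ ((hUinv x _ h1.1).1 hx)).2.1
  choose k hk using hend
  have hk_one : k 1 = 𝟙 o := by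
    refine Arrow.mk_injective _ _ ?_
    have h2 := (hkerL x (hUp x hx).1 x (R.refl x) (h.kernel.refl x)).2.1
    rw [hk, ← hval x hx x (R.refl x) 1 (h.map_self hxW), h2, (hUp x hx).2.1]
  have hk_mul : ∀ f g, k (g * f) = k f ≫ k g := by
    intro f g
    refine Arrow.mk_injective _ _ ?_
    -- Going from `x` by `f` and then from `φ f x` by `g` gives a pair with `θ`-value `g * f`.
    obtain ⟨h1, hf⟩ := hφx f
    have hy := (hUinv x _ h1).1 hx
    obtain ⟨h2, hg⟩ := (hVp _ (hUp _ hy).1).2.1 g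
    have h3 := hval x hx _ (R.trans h1 h2) (g * f) (by
      rw [h.map_mul x hxW _ _ h1 h2, hf, hg])
    rw [hk, ← h3, (hVp x (hUp x hx).1).2.2.1 _ _ h1 h2]
    exact arrow_mk_comp_congr ((hval x hx _ h1 f hf).trans (hk f).symm)
      ((hval _ hy _ h2 g hg).trans (hk g).symm)
  let K : SingleObj Λ ⥤ H.Ob :=
    { obj := fun _ => o
      map := fun g => k g
      map_id := fun _ => hk_one
      map_comp := fun f g => hk_mul f g }
  refine ⟨⟨K, measurable_from_top, measurable_from_top⟩, ?_⟩
  filter_upwards [hU] with y hy z hyz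
  rw [hval y hy z hyz _ rfl]
  exact hk (θ y z)

/-- The quotient by the ergodic kernel of a class-surjective cocycle is the group. -/
theorem IsCocycleOn.quotientIso_kernel (h : IsCocycleOn R W θ) (hR : MeasurableSet (graph R))
    (hpmp : IsMeasurePreserving μ R) (hWm : MeasurableSet W) (hW : ∀ᵐ x ∂μ, x ∈ W)
    (hm : ∀ g, MeasurableSet {p : X × X | (R p.1 p.2 ∧ p.1 ∈ W) ∧ θ p.1 p.2 = g})
    (herg : IsErgodic μ h.kernel) {φ : Λ → X → X} (hφ : ∀ g, Measurable (φ g))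
    (hφθ : ∀ᵐ x ∂μ, ∀ g, R x (φ g x) ∧ θ x (φ g x) = g) :
    QuotientIso.{u, v, a', b'} μ R h.kernel Λ := by
  classical
  have hmap : ∀ x ∈ W, ∀ y (hxy : R x y), (h.relHom hWm hW hm).map x y hxy =
      (show SingleObj.star Λ ⟶ SingleObj.star Λ from θ x y) := fun x hx y hxy => if_pos hx
  refine ⟨h.relHom hWm hW hm, ?_, ?_, ?_⟩
  · filter_upwards [hW] with x hx y hxy
    rw [h.kernel_iff hx hxy, RelHom.InKernel, hmap x hx y hxy]
    exact ⟨fun e => ⟨rfl, e⟩, fun ⟨_, e⟩ => e⟩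
  · filter_upwards [hW, hφθ] with x hx hxφ f _
    let g : Λ := f.hom
    refine ⟨φ g x, (hxφ g).1, ?_⟩
    rw [hmap x hx _ (hxφ g).1, (hxφ g).2]
    rfl
  · intro H' θ' hker
    obtain ⟨κ, hκ⟩ := h.exists_factor hR hpmp hW herg hφ hφθ H' θ' hker
    refine ⟨κ, ?_⟩
    filter_upwards [hκ, hW] with x hx hxW y hxy
    rw [hmap x hxW y hxy]
    exact hx y hxy

end Kernel

end MeasuredRel

/-! ### Largeness, with the kernel of the cocycle as `N`. -/

theorem theorem3 {X : Type u} [MeasurableSpace X] [StandardBorelSpace X]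
    (μ : MeasureTheory.Measure X) [MeasureTheory.IsProbabilityMeasure μ]
    (R : Setoid X) (hR : MeasuredRel.IsDiscreteBorel R)
    (hpmp : MeasuredRel.IsMeasurePreserving μ R) (herg : MeasuredRel.IsErgodic μ R)
    (htree : MeasuredRel.IsTreeable μ R) (hcost : 1 < MeasuredRel.cost μ R)
    (hS : ∃ S : Setoid X, MeasuredRel.IsSubrelation S R ∧ MeasuredRel.IsErgodic μ S ∧
      MeasuredRel.IsPrimitive μ S R ∧ ¬ MeasuredRel.AgreeAE μ S R) :
    MeasuredRel.IsLarge.{u, v, a', b'} μ R := by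
  obtain ⟨S, hSR, hSerg, hprim, hagree⟩ := hS
  have hne : ¬ ∀ᵐ x ∂μ, ∀ y, R x y → S x y := by
    refine fun hae => hagree ((lintegral_congr_ae ?_).trans lintegral_zero)
    filter_upwards [hae] with x hx
    have : {y | (x, y) ∈ symmDiff (MeasuredRel.graph S) (MeasuredRel.graph R)} = ∅ := by
      refine Set.eq_empty_of_forall_notMem fun y hy => ?_
      rcases hy with ⟨h1, h2⟩ | ⟨h1, h2⟩
      · exact h2 (hSR.le x y h1)
      · exact h2 (hx y h1)
    rw [this, Set.encard_empty, ENat.toENNReal_zero]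
  intro Λ _ _
  obtain ⟨θ, W, hWm, hW, hinv, hm, hmul, hθS, hsurj⟩ :=
    MeasuredRel.exists_cocycle Λ hR hpmp hSR hSerg hprim hne
  have hc : MeasuredRel.IsCocycleOn R W θ := ⟨hinv, hmul⟩
  have hN := hc.isErgodic_kernel hWm hW hSR.le hSerg hθS
  choose φ hφ hφθ using fun g => MeasuredRel.exists_measurable_choice hW hm hsurj g
  have hφθ' := ae_all_iff.2 hφθ
  exact ⟨hc.kernel, hc.isSubrelation_kernel hm, hN,
    hc.isNormal_kernel hR.measurableSet_graph hpmp hW hφ hφθ',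
    hc.quotientIso_kernel hR.measurableSet_graph hpmp hWm hW hm hN hφ hφθ'⟩
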